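/- A \emph{metric} on a finite-dimensional real vector space $V$ is a nondegenerate symmetric bilinear form $\langle\cdot,\cdot\rangle$ on $V$ (of arbitrary signature), and $\mathfrak{so}(V)$ is the Lie algebra of endomorphisms of $V$ that are skew-symmetric with respect to it. A \emph{data set} $(\mathfrak g,\mathfrak v,\pi)$ consists of a finite-dimensional real Lie algebra $\mathfrak g$ with a metric $\langle\cdot,\cdot\rangle_{\mathfrak g}$ such that $\operatorname{ad}_Z\in\mathfrak{so}(\mathfrak g)$ for all $Z\in\mathfrak g$, a finite-dimensional real vector space $\mathfrak v$ with a metric $\langle\cdot,\cdot\rangle_{\mathfrak v}$, and a faithful representation $\pi:\mathfrak g\to\operatorname{End}(\mathfrak v)$ without trivial subrepresentations, i.e. $\bigcap_{Z\in\mathfrak g}\ker\pi(Z)=\{0\}$, such that $\pi(Z)\in\mathfrak{so}(\mathfrak v)$ for all $Z\in\mathfrak g$. It is a \emph{Lorentzian data set} if the metric on $\mathfrak n=\mathfrak g\oplus\mathfrak v$ that restricts to $\langle\cdot,\cdot\rangle_{\mathfrak g}$ on $\mathfrak g$ and to $\langle\cdot,\cdot\rangle_{\mathfrak v}$ on $\mathfrak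 v$ and satisfies $\langle\mathfrak g,\mathfrak v\rangle=0$ has signature one, i.e. the maximal dimension of a negative definite subspace is one. \textbf{Corollary.} Let $(\mathfrak g,\mathfrak v,\pi)$ be a Lorentzian data set. Then $\mathfrak g$ is not semisimple; moreover its center $\mathfrak c$ is nonzero. -/

import Mathlib

attribute [local instance 100] LieRing.ofAssociativeRing

/-- The data carried by a data set `(𝔤, 𝔳, π)`: a metric (nondegenerate symmetric bilinear form, of
arbitrary signature) on the real Lie algebra `𝔤` for which every `ad Z` is skew, a metric on the
real vector space `𝔳`, and a faithful representation `π : 𝔤 → 𝔰𝔬(𝔳)` without trivial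
subrepresentations. -/
structure LieDataSet (𝔤 𝔳 : Type*) [LieRing 𝔤] [LieAlgebra ℝ 𝔤] [AddCommGroup 𝔳] [Module ℝ 𝔳] where
  /-- the metric of `𝔤` -/
  formG : LinearMap.BilinForm ℝ 𝔤
  formG_symm : formG.IsSymm
  formG_nondegenerate : formG.Nondegenerate
  /-- ad-invariance: `ad Z ∈ 𝔰𝔬(𝔤)` -/
  ad_mem_so : ∀ Z : 𝔤, LieAlgebra.ad ℝ 𝔤 Z ∈ skewAdjointLieSubalgebra formG
  /-- the metric of `𝔳` -/
  formV : LinearMap.BilinForm ℝ 𝔳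
  formV_symm : formV.IsSymm
  formV_nondegenerate : formV.Nondegenerate
  /-- the representation -/
  π : 𝔤 →ₗ⁅ℝ⁆ Module.End ℝ 𝔳
  π_faithful : Function.Injective π
  /-- no trivial subrepresentations: the common kernel of all `π Z` is zero -/
  iInf_ker_π : ⨅ Z : 𝔤, LinearMap.ker (π Z) = ⊥
  /-- `π(𝔤)`-invariance of the metric of `𝔳`: `π Z ∈ 𝔰𝔬(𝔳)` -/
  π_mem_so : ∀ Z : 𝔤, π Z ∈ skewAdjointLieSubalgebra formV

namespace LieDataSet

variable {𝔤 𝔳 : Type*} [LieRing 𝔤] [LieAlgebra ℝ 𝔤] [AddCommGroup 𝔳] [Module ℝ 𝔳]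

/-- The metric on `𝔫 = 𝔤 ⊕ 𝔳` that restricts to the given metrics on `𝔤` and `𝔳` and makes these
two summands orthogonal. -/
def metric (D : LieDataSet 𝔤 𝔳) : LinearMap.BilinForm ℝ (𝔤 × 𝔳) :=
  D.formG.compl₁₂ (LinearMap.fst ℝ 𝔤 𝔳) (LinearMap.fst ℝ 𝔤 𝔳) +
    D.formV.compl₁₂ (LinearMap.snd ℝ 𝔤 𝔳) (LinearMap.snd ℝ 𝔤 𝔳)

theorem metric_apply (D : LieDataSet 𝔤 𝔳) (x y : 𝔤 × 𝔳) :
    D.metric x y = D.formG x.1 y.1 + D.formV x.2 y.2 := rfl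

/-- A data set is Lorentzian if the metric on `𝔤 ⊕ 𝔳` has signature (index) one: the maximal
dimension of a negative definite subspace is one. -/
def IsLorentzian (D : LieDataSet 𝔤 𝔳) : Prop :=
  sigNeg D.metric.toQuadraticMap = 1

end LieDataSet

open Module
open scoped Matrix

/-! Suppose the center vanishes. The one negative direction of `𝔤 ⊕ 𝔳` lies in one of the summands.
If `𝔳` has a negative vector, `𝔤` is positive definite and acts on the Lorentzian space `𝔳`;
otherwise `𝔳` is positive definite, the negative trace form of `π` is an invariant inner product on
`𝔤`, and `ad` is Lorentzian. `exists_fixed_vector_of_lorentz` yields a nonzero fixed vector: a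
trivial subrepresentation in the first case, a central element in the second. Semisimple algebras
are centerless, so both claims follow.

The fixed vector is found by induction on dimension. A nondegenerate invariant subspace splits off,
and one of the two pieces contains a negative vector. A degenerate one contains a null vector
spanning an invariant line, on which a centerless algebra with invariant inner product acts
trivially. In the irreducible case the Casimir operator is used: its trace is nonpositive
(`trace_rep_sq_nonpos`), which is incompatible with moving a negative vector. -/

/-- A symmetric bilinear form for which the orthogonal complement of every negative vector is
positive definite. -/
structure LorentzForm {V : Type*} [AddCommGroup V] [Module ℝ V]
    (B : LinearMap.BilinForm ℝ V) : Prop where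
  symm : ∀ x y, B x y = B y x
  pos : ∀ p x, B p p < 0 → B x p = 0 → x ≠ 0 → 0 < B x x

/-- A positive definite symmetric bilinear form on a Lie algebra that is invariant under `ad`. -/
structure InvariantInnerForm {𝔤 : Type*} [LieRing 𝔤] [LieAlgebra ℝ 𝔤]
    (κ : LinearMap.BilinForm ℝ 𝔤) : Prop where
  symm : ∀ x y, κ x y = κ y x
  pos : ∀ x, x ≠ 0 → 0 < κ x x
  inv : ∀ x y z : 𝔤, κ ⁅x, y⁆ z = -κ y ⁅x, z⁆

/-! ### Lorentzian and positive definite forms -/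

section Forms

variable {V : Type*} [AddCommGroup V] [Module ℝ V] {B : LinearMap.BilinForm ℝ V}

theorem LorentzForm.nonneg (hB : LorentzForm B) {p x : V} (hp : B p p < 0) (hx : B x p = 0) :
    0 ≤ B x x := by
  by_cases h : x = 0
  · simp [h]
  · exact (hB.pos p x hp hx h).le

theorem LorentzForm.eq_zero (hB : LorentzForm B) {p x : V} (hp : B p p < 0) (hx : B x p = 0)
    (hxx : B x x ≤ 0) : x = 0 := by
  by_contra h
  exact absurd (hB.pos p x hp hx h) hxx.not_gt

/-- Orthogonal null vectors of a Lorentzian space are linearly dependent. -/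
theorem LorentzForm.exists_smul_eq (hB : LorentzForm B) {p u v : V} (hp : B p p < 0)
    (hu : u ≠ 0) (huu : B u u = 0) (hvv : B v v = 0) (huv : B v u = 0) : ∃ c : ℝ, v = c • u := by
  have hup : B u p ≠ 0 := fun h => hu (hB.eq_zero hp h huu.le)
  -- This coefficient makes `v - c • u` orthogonal to `p`; being null as well, it vanishes.
  refine ⟨B v p / B u p, sub_eq_zero.1 (hB.eq_zero hp ?_ ?_)⟩
  · simp [hup]
  · simp [huu, hvv, huv, hB.symm u v]

/-- Orthonormal bases exist for positive definite forms. -/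
theorem exists_orthonormal_basis_of_pos [FiniteDimensional ℝ V]
    (hs : ∀ x y, B x y = B y x) (hpos : ∀ x, x ≠ 0 → 0 < B x x) :
    ∃ b : Basis (Fin (finrank ℝ V)) ℝ V, ∀ i j, B (b i) (b j) = if i = j then 1 else 0 := by
  obtain ⟨v, hv⟩ := LinearMap.BilinForm.exists_orthogonal_basis (B := B) ⟨hs⟩
  have hp : ∀ i, 0 < B (v i) (v i) := fun i => hpos _ (v.ne_zero i)
  refine ⟨v.isUnitSMul (w := fun i => (√(B (v i) (v i)))⁻¹)
    fun i => (inv_pos.2 (Real.sqrt_pos.2 (hp i))).ne'.isUnit, fun i j => ?_⟩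
  simp only [Basis.isUnitSMul_apply, map_smul, LinearMap.smul_apply, smul_eq_mul]
  split_ifs with h
  · subst h
    have := Real.mul_self_sqrt (hp i).le
    have h2 := (Real.sqrt_pos.2 (hp i)).ne'
    field_simp
    nlinarith
  · have : B (v i) (v j) = 0 := hv h
    simp [this]

variable {ι : Type*} [Fintype ι] [DecidableEq ι]

theorem repr_eq_of_orthonormal {b : Basis ι ℝ V}
    (hb : ∀ i j, B (b i) (b j) = if i = j then 1 else 0) (x : V) (i : ι) :
    b.repr x i = B (b i) x := by
  have h := congrArg (B (b i)) (b.sum_repr x)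
  simpa only [map_sum, map_smul, hb, smul_eq_mul, mul_ite, mul_one, mul_zero,
    Finset.sum_ite_eq, Finset.mem_univ, if_true] using h

theorem sum_apply_smul_of_orthonormal {b : Basis ι ℝ V}
    (hb : ∀ i j, B (b i) (b j) = if i = j then 1 else 0) (x : V) :
    ∑ i, B (b i) x • b i = x := by
  simp_rw [← repr_eq_of_orthonormal hb, b.sum_repr]

theorem trace_eq_sum_of_orthonormal {b : Basis ι ℝ V}
    (hb : ∀ i j, B (b i) (b j) = if i = j then 1 else 0) (T : End ℝ V) :
    LinearMap.trace ℝ V T = ∑ i, B (b i) (T (b i)) := by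
  rw [LinearMap.trace_eq_matrix_trace ℝ b, Matrix.trace]
  simp [LinearMap.toMatrix_apply, repr_eq_of_orthonormal hb]

end Forms

/-! ### Complex eigenvectors as pairs of real vectors -/

section ComplexEigenvectors

variable {n : Type*} [Fintype n]

theorem mulVec_re_im_of_complex_eigenvector {M : Matrix n n ℝ} {z : ℂ} {w : n → ℂ}
    (h : M.map (algebraMap ℝ ℂ) *ᵥ w = z • w) :
    (M *ᵥ fun i => (w i).re) = z.re • (fun i => (w i).re) - z.im • (fun i => (w i).im) ∧
    (M *ᵥ fun i => (w i).im) = z.im • (fun i => (w i).re) + z.re • (fun i => (w i).im) := by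
  constructor <;> ext i <;> have := congrFun h i
  · simpa [Matrix.mulVec, dotProduct] using congrArg Complex.re this
  · simpa [Matrix.mulVec, dotProduct, add_comm] using congrArg Complex.im this

variable [DecidableEq n]

theorem exists_pair_of_matrix_eigenvector {V : Type*} [AddCommGroup V] [Module ℝ V]
    (b : Basis n ℝ V) (T : End ℝ V) {z : ℂ} {w : n → ℂ} (hw : w ≠ 0)
    (h : (LinearMap.toMatrix b b T).map (algebraMap ℝ ℂ) *ᵥ w = z • w) :
    ∃ r s : V, (r ≠ 0 ∨ s ≠ 0) ∧ T r = z.re • r - z.im • s ∧ T s = z.im • r + z.re • s := by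
  obtain ⟨h1, h2⟩ := mulVec_re_im_of_complex_eigenvector h
  refine ⟨b.equivFun.symm fun i => (w i).re, b.equivFun.symm fun i => (w i).im, ?_, ?_, ?_⟩
  · by_contra! hc
    simp only [LinearEquiv.map_eq_zero_iff] at hc
    exact hw (funext fun i => Complex.ext (congrFun hc.1 i) (congrFun hc.2 i))
  · apply b.equivFun.injective
    have := LinearMap.toMatrix_mulVec_repr b b T (b.equivFun.symm fun i => (w i).re)
    simp only [← Basis.equivFun_apply, LinearEquiv.apply_symm_apply] at this
    rw [← this, h1]
    simp only [map_sub, map_smul, LinearEquiv.apply_symm_apply]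
  · apply b.equivFun.injective
    have := LinearMap.toMatrix_mulVec_repr b b T (b.equivFun.symm fun i => (w i).im)
    simp only [← Basis.equivFun_apply, LinearEquiv.apply_symm_apply] at this
    rw [← this, h2]
    simp only [map_add, map_smul, LinearEquiv.apply_symm_apply]

variable {V : Type*} [AddCommGroup V] [Module ℝ V] [FiniteDimensional ℝ V]

theorem exists_complex_eigenpair [Nontrivial V] (T : End ℝ V) :
    ∃ (a b : ℝ) (r s : V), (r ≠ 0 ∨ s ≠ 0) ∧ T r = a • r - b • s ∧ T s = b • r + a • s := by
  have : Nonempty (Fin (finrank ℝ V)) := ⟨⟨0, finrank_pos⟩⟩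
  obtain ⟨z, hz⟩ := Module.End.exists_eigenvalue
    (Matrix.toLin' ((LinearMap.toMatrix (finBasis ℝ V) (finBasis ℝ V) T).map (algebraMap ℝ ℂ)))
  obtain ⟨w, hw⟩ := hz.exists_hasEigenvector
  obtain ⟨r, s, h⟩ := exists_pair_of_matrix_eigenvector _ T hw.2 (by simpa using hw.apply_eq_smul)
  exact ⟨_, _, r, s, h⟩

/-- If the square of an endomorphism has positive trace, then the endomorphism has a complex
eigenvalue that is not purely imaginary. -/
theorem exists_complex_eigenpair_of_trace_sq_pos (T : End ℝ V)
    (hT : 0 < LinearMap.trace ℝ V (T * T)) :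
    ∃ (a b : ℝ) (r s : V), a ≠ 0 ∧
      (r ≠ 0 ∨ s ≠ 0) ∧ T r = a • r - b • s ∧ T s = b • r + a • s := by
  set e := finBasis ℝ V
  set M := (LinearMap.toMatrix e e T).map (algebraMap ℝ ℂ) with hM
  have htr : 0 < (M * M).trace.re := by
    have : M * M = (LinearMap.toMatrix e e (T * T)).map (algebraMap ℝ ℂ) := by
      rw [LinearMap.toMatrix_mul, Matrix.map_mul]
    rw [this, ← AddMonoidHom.map_trace (algebraMap ℝ ℂ), ← LinearMap.trace_eq_matrix_trace ℝ e]
    simpa using hT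
  obtain ⟨z, hz, hz0⟩ : ∃ z ∈ (M * M).charpoly.roots, 0 < z.re := by
    by_contra! hc
    rw [Matrix.trace_eq_sum_roots_charpoly] at htr
    have : ((M * M).charpoly.roots.sum).re = ((M * M).charpoly.roots.map Complex.re).sum :=
      map_multiset_sum Complex.reAddGroupHom _
    rw [this] at htr
    refine htr.not_ge ((Multiset.sum_le_card_nsmul _ 0 fun x hx => ?_).trans (smul_zero _).le)
    obtain ⟨y, hy, rfl⟩ := Multiset.mem_map.1 hx
    exact hc y hy
  have hz' : End.HasEigenvalue (Matrix.toLin' (M * M)) z := by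
    rw [End.hasEigenvalue_iff_isRoot_charpoly, Matrix.charpoly_toLin']
    exact Polynomial.isRoot_of_mem_roots hz
  obtain ⟨w, hw⟩ := hz'.exists_hasEigenvector
  obtain ⟨c, hc⟩ := IsAlgClosed.exists_eq_mul_self z
  have hcre : c.re ≠ 0 := by
    intro h
    rw [hc] at hz0
    simp only [Complex.mul_re, h] at hz0
    nlinarith [mul_self_nonneg c.im]
  have hw1 : M *ᵥ (M *ᵥ w) = (c * c) • w := by
    rw [← hc, Matrix.mulVec_mulVec]; simpa using hw.apply_eq_smul
  -- As `(M - c)(M + c) w = 0`, either `w` is an eigenvector for `-c` or `(M + c) w` is one for `c`.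
  by_cases h0 : M *ᵥ w + c • w = 0
  · obtain ⟨r, s, h⟩ := exists_pair_of_matrix_eigenvector e T (z := -c) hw.2
      (by rw [neg_smul]; exact eq_neg_of_add_eq_zero_left h0)
    exact ⟨_, _, r, s, by simpa using hcre, h⟩
  · obtain ⟨r, s, h⟩ := exists_pair_of_matrix_eigenvector e T (z := c) h0
      (by rw [← hM, Matrix.mulVec_add, hw1, Matrix.mulVec_smul, smul_add, smul_smul, add_comm])
    exact ⟨_, _, r, s, hcre, h⟩

end ComplexEigenvectors

/-! ### Null orbits and the trace form of a Lorentzian representation -/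

section Representation

variable {𝔤 V : Type*} [LieRing 𝔤] [LieAlgebra ℝ 𝔤]
  [AddCommGroup V] [Module ℝ V]
  {κ : LinearMap.BilinForm ℝ 𝔤} {B : LinearMap.BilinForm ℝ V} {ρ : 𝔤 →ₗ⁅ℝ⁆ End ℝ V}

theorem rep_lie_apply (ρ : 𝔤 →ₗ⁅ℝ⁆ End ℝ V) (x y : 𝔤) (v : V) :
    ρ ⁅x, y⁆ v = ρ x (ρ y v) - ρ y (ρ x v) := by
  rw [LieHom.map_lie, LieRing.of_associative_ring_bracket]; rfl

variable [FiniteDimensional ℝ 𝔤]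

/-- A line invariant under a centerless Lie algebra with an invariant inner product is fixed. -/
theorem rep_apply_eq_zero_of_invariant_line (hκ : InvariantInnerForm κ)
    (hc : ∀ x : 𝔤, (∀ y : 𝔤, ⁅x, y⁆ = 0) → x = 0) {u : V} (hu : u ≠ 0)
    (h : ∀ y, ∃ c : ℝ, ρ y u = c • u) (y : 𝔤) : ρ y u = 0 := by
  obtain ⟨f, hf⟩ := Module.Projective.exists_dual_eq_one ℝ hu
  have hχ : ∀ y, ρ y u = f (ρ y u) • u := fun y => by
    obtain ⟨c, hc⟩ := h y
    simp [hc, hf]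
  have hinj : Function.Injective κ := (injective_iff_map_eq_zero κ).2 fun x hx => by
    by_contra h0
    exact (hκ.pos x h0).ne' (by simp [hx])
  have hsurj : Function.Surjective κ :=
    (LinearMap.injective_iff_surjective_of_finrank_eq_finrank
      (Subspace.dual_finrank_eq).symm).1 hinj
  -- The vector `k` represents the character by which `𝔤` acts on the line. Characters kill
  -- brackets, so invariance of `κ` makes `k` central.
  obtain ⟨k, hk⟩ := hsurj (f ∘ₗ (LinearMap.applyₗ u) ∘ₗ (ρ : 𝔤 →ₗ[ℝ] End ℝ V))
  have hk' : ∀ y, κ k y = f (ρ y u) := fun y => by rw [hk]; rfl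
  have hk0 : k = 0 := hc k fun y => by
    have : ∀ z, κ ⁅y, k⁆ z = 0 := fun z => by
      obtain ⟨c, hy⟩ := h y
      obtain ⟨d, hz⟩ := h z
      rw [hκ.inv, hk', rep_lie_apply, hy, hz, map_smul, map_smul, hy, hz, smul_comm, sub_self,
        map_zero, neg_zero]
    rw [← lie_skew, hinj (a₁ := ⁅y, k⁆) (a₂ := 0) (by ext z; simp [this z]), neg_zero]
  rw [hχ, ← hk', hk0]
  simp

/-- By skewness `ρ y u` is orthogonal to `u`; if it is null too, it is a multiple of `u`, so the
line of `u` is invariant. -/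
theorem rep_apply_eq_zero_of_null (hκ : InvariantInnerForm κ)
    (hc : ∀ x : 𝔤, (∀ y : 𝔤, ⁅x, y⁆ = 0) → x = 0) (hB : LorentzForm B)
    (hρ : ∀ x v w, B (ρ x v) w = -B v (ρ x w)) {p u : V} (hp : B p p < 0) (hu : u ≠ 0)
    (huu : B u u = 0) (h : ∀ y, B (ρ y u) (ρ y u) = 0) (y : 𝔤) : ρ y u = 0 := by
  refine rep_apply_eq_zero_of_invariant_line hκ hc hu (fun y => ?_) y
  refine hB.exists_smul_eq hp hu huu (h y) ?_
  linarith [hρ y u u, hB.symm u (ρ y u)]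

/-- The orbit under the Lie algebra of an eigenvector for a nonzero real eigenvalue is totally
isotropic. -/
theorem rep_null_of_eigenvector (hκ : InvariantInnerForm κ) (hB : LorentzForm B)
    (hρ : ∀ x v w, B (ρ x v) w = -B v (ρ x w)) {u : V} {x : 𝔤} {l : ℝ} (hl : l ≠ 0)
    (hxu : ρ x u = l • u) (y z : 𝔤) : B (ρ y u) (ρ z u) = 0 := by
  obtain ⟨e, he⟩ := exists_orthonormal_basis_of_pos hκ.symm hκ.pos
  let β : LinearMap.BilinForm ℝ 𝔤 :=
    B.compl₁₂ ((LinearMap.applyₗ u) ∘ₗ (ρ : 𝔤 →ₗ[ℝ] End ℝ V))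
      ((LinearMap.applyₗ u) ∘ₗ (ρ : 𝔤 →ₗ[ℝ] End ℝ V))
  have hβ : ∀ y z, β y z = B (ρ y u) (ρ z u) := fun y z => rfl
  have hD : ∀ y z, 2 * l * β y z + β ⁅x, y⁆ z + β y ⁅x, z⁆ = 0 := fun y z => by
    have h := hρ x (ρ y u) (ρ z u)
    simp only [hβ, rep_lie_apply, hxu, map_smul, map_sub, LinearMap.sub_apply,
      LinearMap.smul_apply, smul_eq_mul]
    linarith
  let b : Matrix _ _ ℝ := .of fun i j => β (e i) (e j)
  let a : Matrix _ _ ℝ := .of fun i j => κ (e j) ⁅x, e i⁆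
  have ha : aᵀ = -a := by
    ext i j
    simp only [a, Matrix.transpose_apply, Matrix.of_apply, Matrix.neg_apply]
    rw [hκ.symm, hκ.inv]
  have hbs : bᵀ = b := by
    ext i j
    simp only [b, Matrix.transpose_apply, Matrix.of_apply, hβ]
    exact hB.symm _ _
  have hab : (2 * l) • b + a * b - b * a = 0 := by
    rw [sub_eq_add_neg, ← mul_neg, ← ha]
    ext i j
    have h1 : β ⁅x, e i⁆ (e j) = ∑ k, κ (e k) ⁅x, e i⁆ * β (e k) (e j) := by
      conv_lhs => rw [← sum_apply_smul_of_orthonormal he ⁅x, e i⁆]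
      simp
    have h2 : β (e i) ⁅x, e j⁆ = ∑ k, κ (e k) ⁅x, e j⁆ * β (e i) (e k) := by
      conv_lhs => rw [← sum_apply_smul_of_orthonormal he ⁅x, e j⁆]
      simp
    have h3 := hD (e i) (e j)
    rw [h1, h2] at h3
    simpa [Matrix.mul_apply, a, b, mul_comm] using h3
  have hb : b = 0 := by
    rw [← Matrix.trace_conjTranspose_mul_self_eq_zero_iff, Matrix.conjTranspose_eq_transpose_of_trivial,
      hbs]
    -- Multiplying by `b` and taking the trace kills the commutator, leaving `2 * l * trace (b * b)
    -- = 0` with `b` symmetric.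
    have h := congrArg (fun m => Matrix.trace (b * m)) hab
    simp only [mul_sub, mul_add, Matrix.trace_sub, Matrix.trace_add, mul_zero, Matrix.trace_zero,
      Matrix.mul_smul, Matrix.trace_smul, ← mul_assoc, Matrix.trace_mul_cycle b a b, smul_eq_mul,
      add_sub_cancel_right] at h
    simpa [hl] using h
  have hβ0 : β = 0 := e.ext fun i => e.ext fun j => congrFun (congrFun hb i) j
  rw [← hβ, hβ0]
  rfl

variable [FiniteDimensional ℝ V]

/-- The trace form of a Lorentzian representation of a centerless Lie algebra with an invariant
inner product is negative semidefinite. -/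
theorem trace_rep_sq_nonpos (hκ : InvariantInnerForm κ)
    (hc : ∀ x : 𝔤, (∀ y : 𝔤, ⁅x, y⁆ = 0) → x = 0) (hB : LorentzForm B)
    (hρ : ∀ x v w, B (ρ x v) w = -B v (ρ x w)) {p : V} (hp : B p p < 0)
    (x : 𝔤) : LinearMap.trace ℝ V (ρ x * ρ x) ≤ 0 := by
  by_contra! hT
  have hreal : ∀ (u : V) (l : ℝ), l ≠ 0 → u ≠ 0 → ρ x u ≠ l • u := fun u l hl hu hxu => by
    have huu : B u u = 0 := by
      have h := hρ x u u
      simp only [hxu, map_smul, LinearMap.smul_apply, smul_eq_mul] at h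
      exact (mul_eq_zero.1 (show l * B u u = 0 by linarith)).resolve_left hl
    have h0 := rep_apply_eq_zero_of_null hκ hc hB hρ hp hu huu
      (fun y => rep_null_of_eigenvector hκ hB hρ hl hxu y y) x
    exact smul_ne_zero hl hu (hxu.symm.trans h0)
  obtain ⟨a, b, r, s, ha, hrs, hr, hs⟩ := exists_complex_eigenpair_of_trace_sq_pos (ρ x) hT
  -- Since `a ≠ 0`, skewness makes the span of `r` and `s` totally isotropic. It is therefore a
  -- line, which gives a real eigenvector excluded by `hreal`.
  have h1 := hρ x r r
  have h2 := hρ x s s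
  have h3 := hρ x r s
  have hsym := hB.symm s r
  simp only [hr, hs, map_sub, map_add, map_smul, LinearMap.sub_apply, LinearMap.add_apply,
    LinearMap.smul_apply, smul_eq_mul, hsym] at h1 h2 h3
  have hpos : 0 < a ^ 2 + b ^ 2 := by positivity
  have hm : B r s = 0 := by
    have : (a ^ 2 + b ^ 2) * B r s = 0 := by linear_combination a / 2 * h3 - b / 4 * h1 + b / 4 * h2
    exact (mul_eq_zero.1 this).resolve_left hpos.ne'
  have hrr : B r r = 0 := by
    rw [hm] at h1
    exact (mul_eq_zero.1 (show a * B r r = 0 by linarith)).resolve_left ha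
  have hss : B s s = 0 := by
    rw [hm] at h2
    exact (mul_eq_zero.1 (show a * B s s = 0 by linarith)).resolve_left ha
  by_cases hs0 : s = 0
  · subst hs0
    exact hreal r a ha (by simpa using hrs) (by simpa using hr)
  · obtain ⟨c, rfl⟩ := hB.exists_smul_eq hp hs0 hss hrr hm
    have hs' : ρ x s = (b * c + a) • s := by rw [hs, smul_smul, add_smul]
    rw [map_smul, hs', smul_smul, smul_smul, ← sub_smul] at hr
    have h4 := smul_left_injective ℝ hs0 hr
    have hb : b = 0 := by
      have : b * (c ^ 2 + 1) = 0 := by linear_combination h4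
      exact (mul_eq_zero.1 this).resolve_right (by positivity)
    exact hreal s _ (by simpa [hb] using ha) hs0 hs'

end Representation

/-! ### The Casimir operator and fixed vectors -/

section FixedVector

variable {𝔤 : Type*} [LieRing 𝔤] [LieAlgebra ℝ 𝔤] {κ : LinearMap.BilinForm ℝ 𝔤}

/-- The Casimir operator of a representation with respect to an orthonormal basis commutes with
the representation. -/
theorem commute_sum_rep_sq {V : Type*} [AddCommGroup V] [Module ℝ V]
    {ρ : 𝔤 →ₗ⁅ℝ⁆ End ℝ V} {ι : Type*} [Fintype ι] [DecidableEq ι] (hκ : InvariantInnerForm κ)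
    {e : Basis ι ℝ 𝔤} (he : ∀ i j, κ (e i) (e j) = if i = j then 1 else 0) (y : 𝔤) :
    ρ y * ∑ i, ρ (e i) * ρ (e i) = (∑ i, ρ (e i) * ρ (e i)) * ρ y := by
  have hanti : ∀ i j, κ (e i) ⁅y, e j⁆ = -κ (e j) ⁅y, e i⁆ := fun i j => by
    rw [hκ.symm, hκ.inv]
  have hbr : ∀ i, ρ y * ρ (e i) - ρ (e i) * ρ y = ∑ j, κ (e j) ⁅y, e i⁆ • ρ (e j) := fun i => by
    rw [← LieRing.of_associative_ring_bracket, ← LieHom.map_lie]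
    conv_lhs => rw [← sum_apply_smul_of_orthonormal he ⁅y, e i⁆]
    rw [map_sum]
    simp only [map_smul]
  rw [← sub_eq_zero, Finset.mul_sum, Finset.sum_mul, ← Finset.sum_sub_distrib]
  have : ∀ i, ρ y * (ρ (e i) * ρ (e i)) - ρ (e i) * ρ (e i) * ρ y =
      (∑ j, κ (e j) ⁅y, e i⁆ • (ρ (e j) * ρ (e i))) +
        ∑ j, κ (e j) ⁅y, e i⁆ • (ρ (e i) * ρ (e j)) := fun i => by
    have h1 : ρ y * (ρ (e i) * ρ (e i)) - ρ (e i) * ρ (e i) * ρ y =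
      (ρ y * ρ (e i) - ρ (e i) * ρ y) * ρ (e i) + ρ (e i) * (ρ y * ρ (e i) - ρ (e i) * ρ y) := by
      noncomm_ring
    rw [h1, hbr, Finset.sum_mul, Finset.mul_sum]
    simp only [smul_mul_assoc, mul_smul_comm]
  simp_rw [this]
  rw [Finset.sum_add_distrib]
  -- Once the indices of the second double sum are swapped, antisymmetry of the coefficients cancels
  -- it against the first.
  nth_rewrite 2 [Finset.sum_comm]
  rw [← Finset.sum_add_distrib]
  refine Finset.sum_eq_zero fun i _ => ?_
  rw [← Finset.sum_add_distrib]
  refine Finset.sum_eq_zero fun j _ => ?_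
  rw [hanti i j, neg_smul, add_neg_cancel]

variable [FiniteDimensional ℝ 𝔤]

/-- An irreducible Lorentzian representation has a fixed negative vector. -/
theorem rep_apply_eq_zero_of_irreducible {V : Type*} [AddCommGroup V] [Module ℝ V]
    [FiniteDimensional ℝ V] {B : LinearMap.BilinForm ℝ V} {ρ : 𝔤 →ₗ⁅ℝ⁆ End ℝ V}
    (hκ : InvariantInnerForm κ)
    (hc : ∀ x : 𝔤, (∀ y : 𝔤, ⁅x, y⁆ = 0) → x = 0) (hB : LorentzForm B)
    (hρ : ∀ x v w, B (ρ x v) w = -B v (ρ x w)) {p : V} (hp : B p p < 0)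
    (hirr : ∀ U : Submodule ℝ V, (∀ x, ∀ v ∈ U, ρ x v ∈ U) → U = ⊥ ∨ U = ⊤) (x : 𝔤) :
    ρ x p = 0 := by
  have hp0 : p ≠ 0 := by rintro rfl; simp at hp
  have : Nontrivial V := ⟨p, 0, hp0⟩
  obtain ⟨e, he⟩ := exists_orthonormal_basis_of_pos hκ.symm hκ.pos
  obtain ⟨C, hC⟩ : ∃ C, C = ∑ i, ρ (e i) * ρ (e i) := ⟨_, rfl⟩
  have hcomm : ∀ y v, ρ y (C v) = C (ρ y v) := fun y v => by
    have := congrArg (fun T : End ℝ V => T v) (commute_sum_rep_sq (ρ := ρ) hκ he y)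
    rwa [← hC] at this
  have hself : ∀ v w, B (C v) w = B v (C w) := fun v w => by
    simp [hC, LinearMap.sum_apply, hρ]
  -- Schur's lemma: the kernel of a commuting operator is invariant.
  have hker : ∀ T : End ℝ V, (∀ y v, ρ y (T v) = T (ρ y v)) → (∃ v, v ≠ 0 ∧ T v = 0) →
      ∀ v, T v = 0 := fun T hT ⟨v, hv, hTv⟩ w => by
    rcases hirr (LinearMap.ker T) fun y u hu => by
      rw [LinearMap.mem_ker] at hu ⊢
      rw [← hT, hu, map_zero] with h | h
    · exact absurd ((Submodule.mem_bot ℝ).1 (h ▸ LinearMap.mem_ker.2 hTv)) hv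
    · exact LinearMap.mem_ker.1 (h ▸ Submodule.mem_top)
  have horth : ∀ y, B (ρ y p) p = 0 := fun y => by linarith [hρ y p p, hB.symm p (ρ y p)]
  obtain ⟨a, b, r, s, hrs, hr, hs⟩ := exists_complex_eigenpair C
  by_cases hb : b = 0
  · subst hb
    have hCa : ∀ v, C v = a • v := fun v => by
      have := hker (C - a • LinearMap.id) (fun y v => by simp [hcomm]) (by
        rcases hrs with h | h
        · exact ⟨r, h, by simp [hr]⟩
        · exact ⟨s, h, by simp [hs]⟩) v
      simpa [sub_eq_zero] using this
    have ha : a ≤ 0 := by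
      have h1 : LinearMap.trace ℝ V C ≤ 0 := by
        rw [hC, map_sum]
        exact Finset.sum_nonpos fun i _ => trace_rep_sq_nonpos hκ hc hB hρ hp (e i)
      have h2 : C = a • LinearMap.id := LinearMap.ext hCa
      rw [h2, map_smul, LinearMap.trace_id, smul_eq_mul] at h1
      have h3 : (0 : ℝ) < finrank ℝ V := by exact_mod_cast finrank_pos
      by_contra! h4
      exact h1.not_gt (mul_pos h4 h3)
    -- The right side is nonpositive because `a ≤ 0`, while each summand is nonnegative, `ρ (e i) p`
    -- being orthogonal to `p`.
    have hsum : ∑ i, B (ρ (e i) p) (ρ (e i) p) = -(a * B p p) := by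
      rw [← smul_eq_mul, ← map_smul, ← hCa, hC]
      simp [LinearMap.sum_apply, hρ]
    have hnn : ∀ i, 0 ≤ B (ρ (e i) p) (ρ (e i) p) := fun i => hB.nonneg hp (horth _)
    have h0 : ∑ i, B (ρ (e i) p) (ρ (e i) p) = 0 :=
      le_antisymm (by rw [hsum]; nlinarith) (Finset.sum_nonneg fun i _ => hnn i)
    have hz : ∀ i, ρ (e i) p = 0 := fun i => hB.eq_zero hp (horth _)
      ((Finset.sum_eq_zero_iff_of_nonneg fun i _ => hnn i).1 h0 i (Finset.mem_univ i)).le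
    have hlin : LinearMap.applyₗ p ∘ₗ (ρ : 𝔤 →ₗ[ℝ] End ℝ V) = 0 := e.ext hz
    exact LinearMap.congr_fun hlin x
  · obtain ⟨T, hT⟩ : ∃ T, T = C - a • LinearMap.id := ⟨_, rfl⟩
    have hTcomm : ∀ y v, ρ y (T v) = T (ρ y v) := fun y v => by simp [hT, hcomm]
    have hTself : ∀ v w, B (T v) w = B v (T w) := fun v w => by simp [hT, hself]
    have hTr : T r = -(b • s) := by simp [hT, hr]
    have hTs : T s = b • r := by simp [hT, hs]
    have hTT : ∀ v, T (T v) = -(b ^ 2) • v := fun v => by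
      have := hker (T * T + b ^ 2 • LinearMap.id) (fun y v => by simp [hTcomm]) (by
        rcases hrs with h | h
        · exact ⟨r, h, by simp [hTr, hTs, smul_smul, sq]⟩
        · exact ⟨s, h, by simp [hTr, hTs, smul_smul, sq]⟩) v
      rw [neg_smul]
      exact eq_neg_of_add_eq_zero_left this
    -- `ρ x` is skew and commutes with the self-adjoint `T`, so their product is skew. Thus `ρ x p`
    -- and `T (ρ x p)` are both orthogonal to `p`, yet `T` multiplies squared lengths by `-(b ^ 2)`.
    have h1 : B (T (ρ x p)) p = 0 := by
      have h2 := hρ x p (T p)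
      rw [hTcomm, ← hTself, ← hTself p, ← hTcomm, hB.symm (T p)] at h2
      have h3 := hρ x (T p) p
      rw [hTcomm, hB.symm (T p)] at h3
      have h4 := hTself (ρ x p) p
      linarith
    have h2 := hB.nonneg hp h1
    rw [← hTself, hTT, map_smul, LinearMap.smul_apply, smul_eq_mul] at h2
    exact hB.eq_zero hp (horth x) (by have : 0 < b ^ 2 := by positivity
                                      nlinarith)

/-- The restriction of a representation to an invariant subspace. -/
def LieHom.restrictInvariant {V : Type*} [AddCommGroup V] [Module ℝ V] (ρ : 𝔤 →ₗ⁅ℝ⁆ End ℝ V)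
    (U : Submodule ℝ V) (hU : ∀ x, ∀ v ∈ U, ρ x v ∈ U) : 𝔤 →ₗ⁅ℝ⁆ End ℝ U where
  toFun x := (ρ x).restrict (hU x)
  map_add' x y := by ext v; simp
  map_smul' c x := by ext v; simp
  map_lie' {x y} := by
    ext v
    simp [LieRing.of_associative_ring_bracket]

/-- A centerless Lie algebra with an invariant inner product has a nonzero fixed vector in each of
its Lorentzian representations. -/
theorem exists_fixed_vector_of_lorentz (hκ : InvariantInnerForm κ)
    (hc : ∀ x : 𝔤, (∀ y : 𝔤, ⁅x, y⁆ = 0) → x = 0) (n : ℕ) :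
    ∀ {V : Type*} [AddCommGroup V] [Module ℝ V] [FiniteDimensional ℝ V]
      {B : LinearMap.BilinForm ℝ V} {ρ : 𝔤 →ₗ⁅ℝ⁆ End ℝ V}, finrank ℝ V = n → LorentzForm B →
      (∀ x v w, B (ρ x v) w = -B v (ρ x w)) → ∀ p : V, B p p < 0 →
      ∃ u : V, u ≠ 0 ∧ ∀ y, ρ y u = 0 := by
  induction n using Nat.strong_induction_on with
  | _ n ih =>
  intro V _ _ _ B ρ hn hB hρ p hp
  have key : ∀ U : Submodule ℝ V, (∀ x, ∀ v ∈ U, ρ x v ∈ U) → U ≠ ⊤ → ∀ q ∈ U, B q q < 0 →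
      ∃ u : V, u ≠ 0 ∧ ∀ y, ρ y u = 0 := fun U hU hUt q hq hqq => by
    obtain ⟨u, hu, h⟩ := ih (finrank ℝ U) (hn ▸ Submodule.finrank_lt hUt)
      (B := B.domRestrict₁₂ U U) (ρ := ρ.restrictInvariant U hU) rfl
      ⟨fun x y => hB.symm _ _, fun p x hp hx h => hB.pos p x hp hx (by simpa using h)⟩
      (fun x v w => hρ x v w) ⟨q, hq⟩ hqq
    exact ⟨u, by simpa using hu, fun y => congrArg Subtype.val (h y)⟩
  by_cases hirr : ∀ U : Submodule ℝ V, (∀ x, ∀ v ∈ U, ρ x v ∈ U) → U = ⊥ ∨ U = ⊤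
  · exact ⟨p, by rintro rfl; simp at hp, rep_apply_eq_zero_of_irreducible hκ hc hB hρ hp hirr⟩
  push Not at hirr
  obtain ⟨U, hU, hU0, hU1⟩ := hirr
  have hrefl : B.IsRefl := fun x y h => by rw [hB.symm, h]
  have hU' : ∀ x, ∀ v ∈ B.orthogonal U, ρ x v ∈ B.orthogonal U := fun x v hv w hw => by
    have h1 : B (ρ x w) v = 0 := hv _ (hU x w hw)
    rw [hρ, neg_eq_zero] at h1
    exact h1
  by_cases hd : Disjoint U (B.orthogonal U)
  · have hcompl : IsCompl U (B.orthogonal U) :=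
      (LinearMap.BilinForm.restrict_nondegenerate_iff_isCompl_orthogonal hrefl).1
        (LinearMap.BilinForm.nondegenerate_restrict_of_disjoint_orthogonal B hrefl hd)
    obtain ⟨q, hq, q', hq', rfl⟩ := Submodule.mem_sup.1
      (hcompl.sup_eq_top ▸ Submodule.mem_top : p ∈ U ⊔ B.orthogonal U)
    have hqq : B q q' = 0 := hq' q hq
    rcases lt_or_ge (B q q) 0 with h | h
    · exact key U hU hU1 q hq h
    · refine key _ hU' (fun h => hU0 ?_) q' hq' ?_
      · simpa [h] using hd
      · simp [hqq, hB.symm q' q] at hp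
        linarith
  · rw [Submodule.disjoint_def] at hd
    push Not at hd
    -- `U` meets its complement in an invariant totally isotropic space, so the orbit of `u` is
    -- null.
    obtain ⟨u, hu, hu', hu0⟩ := hd
    exact ⟨u, hu0, rep_apply_eq_zero_of_null hκ hc hB hρ hp hu0 (hu' u hu)
      fun y => hU' y u hu' _ (hU y u hu)⟩

end FixedVector

/-! ### From signature one to Lorentzian forms -/

section Signature

variable {V : Type*} [AddCommGroup V] [Module ℝ V] {B : LinearMap.BilinForm ℝ V}

theorem lorentzForm_of_sigNeg_eq_one [FiniteDimensional ℝ V] (hs : ∀ x y, B x y = B y x)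
    (hn : ∀ x, (∀ y, B x y = 0) → x = 0) (h1 : sigNeg B.toQuadraticMap = 1) : LorentzForm B := by
  have hnn : ∀ p x, B p p < 0 → B x p = 0 → 0 ≤ B x x := fun p x hp hx => by
    by_contra! hxx
    have hli : LinearIndependent ℝ ![p, x] := by
      refine LinearIndependent.pair_iff.2 fun s t h => ?_
      have e1 := congrArg (fun v => B v p) h
      have e2 := congrArg (fun v => B v x) h
      simp only [map_add, map_smul, LinearMap.add_apply, LinearMap.smul_apply, smul_eq_mul, hx,
        hs p x, mul_zero, add_zero, zero_add, map_zero, LinearMap.zero_apply, mul_eq_zero, hp.ne,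
        hxx.ne, or_false] at e1 e2
      exact ⟨e1, e2⟩
    have hdim := le_sigNeg_of_negDef (Q := B.toQuadraticMap)
      (V := Submodule.span ℝ (Set.range ![p, x])) (by
        rintro ⟨v, hv⟩ hv0
        rw [Matrix.range_cons_cons_empty, Submodule.mem_span_pair] at hv
        obtain ⟨s, t, rfl⟩ := hv
        have hst : s ≠ 0 ∨ t ≠ 0 := by
          by_contra! hst
          exact hv0 (by simp [hst.1, hst.2])
        change 0 < -(B (s • p + t • x) (s • p + t • x))
        simp only [map_add, map_smul, LinearMap.add_apply, LinearMap.smul_apply, smul_eq_mul, hx,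
          hs p x]
        rcases hst with h | h
        · nlinarith [mul_pos (sq_pos_of_ne_zero h) (neg_pos.2 hp),
            mul_nonneg (sq_nonneg t) (neg_pos.2 hxx).le]
        · nlinarith [mul_nonneg (sq_nonneg s) (neg_pos.2 hp).le,
            mul_pos (sq_pos_of_ne_zero h) (neg_pos.2 hxx)])
    rw [finrank_span_eq_card hli, h1] at hdim
    simp at hdim
  refine ⟨hs, fun p x hp hx hx0 => (hnn p x hp hx).lt_of_ne' fun hxx => hx0 (hn x fun y => ?_)⟩
  by_contra hxy
  -- `z` is the projection of `y` to the complement of `p`. If `x` is null there and not orthogonal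
  -- to `z`, a suitable `z - t • x` has square `-1`.
  obtain ⟨z, hz⟩ : ∃ z, z = y - (B y p / B p p) • p := ⟨_, rfl⟩
  have hzp : B z p = 0 := by simp [hz, hp.ne]
  have hzx : B z x = B x y := by simp [hz, hs p x, hx, hs y x]
  have h := hnn p (z - ((B z z + 1) / (2 * B x y)) • x) hp (by simp [hzp, hx])
  have hval : B (z - ((B z z + 1) / (2 * B x y)) • x) (z - ((B z z + 1) / (2 * B x y)) • x) = -1 := by
    simp only [map_sub, map_smul, LinearMap.sub_apply, LinearMap.smul_apply, smul_eq_mul, hxx,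
      hs x z, hzx]
    field_simp
    ring
  linarith

theorem exists_neg_of_sigNeg_eq_one [FiniteDimensional ℝ V] (h1 : sigNeg B.toQuadraticMap = 1) :
    ∃ p, B p p < 0 := by
  obtain ⟨W, hW, hneg⟩ := exists_finrank_eq_sigNeg_and_negDef B.toQuadraticMap
  have : Nontrivial W := (finrank_pos_iff (R := ℝ)).1 (by rw [hW, h1]; exact one_pos)
  obtain ⟨w, hw⟩ := exists_ne (0 : W)
  exact ⟨w, neg_pos.1 (hneg w hw)⟩

/-- A symmetric nondegenerate form without negative vectors is positive definite. -/
theorem pos_of_forall_nonneg (hs : ∀ x y, B x y = B y x)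
    (hn : ∀ x, (∀ y, B x y = 0) → x = 0) (h : ∀ x, 0 ≤ B x x) (x : V) (hx : x ≠ 0) :
    0 < B x x := by
  refine (h x).lt_of_ne' fun hxx => hx (hn x fun y => ?_)
  by_contra hxy
  have h := h (y - ((B y y + 1) / (2 * B x y)) • x)
  have hval : B (y - ((B y y + 1) / (2 * B x y)) • x) (y - ((B y y + 1) / (2 * B x y)) • x) = -1 := by
    simp only [map_sub, map_smul, LinearMap.sub_apply, LinearMap.smul_apply, smul_eq_mul, hxx,
      hs y x]
    field_simp
    ring
  linarith

end Signature

/-- The negative of the trace form of a faithful orthogonal representation is an invariant inner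
product. -/
theorem exists_invariantInnerForm_of_faithful {𝔤 V : Type*} [LieRing 𝔤] [LieAlgebra ℝ 𝔤]
    [AddCommGroup V] [Module ℝ V] [FiniteDimensional ℝ V] {B : LinearMap.BilinForm ℝ V}
    {ρ : 𝔤 →ₗ⁅ℝ⁆ End ℝ V} (hinj : Function.Injective ρ) (hs : ∀ x y, B x y = B y x)
    (hpos : ∀ x, x ≠ 0 → 0 < B x x) (hρ : ∀ x v w, B (ρ x v) w = -B v (ρ x w)) :
    ∃ κ : LinearMap.BilinForm ℝ 𝔤, InvariantInnerForm κ := by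
  obtain ⟨b, hb⟩ := exists_orthonormal_basis_of_pos hs hpos
  have hnn : ∀ v, 0 ≤ B v v := fun v => by
    by_cases hv : v = 0
    · simp [hv]
    · exact (hpos v hv).le
  refine ⟨-((LinearMap.mul ℝ (End ℝ V)).compr₂ (LinearMap.trace ℝ V)).compl₁₂
    (ρ : 𝔤 →ₗ[ℝ] End ℝ V) (ρ : 𝔤 →ₗ[ℝ] End ℝ V), ⟨fun x y => ?_, fun x hx => ?_, fun x y z => ?_⟩⟩
  · simp [LinearMap.trace_mul_comm ℝ (ρ x)]
  · have h : LinearMap.trace ℝ V (ρ x * ρ x) = -∑ i, B (ρ x (b i)) (ρ x (b i)) := by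
      rw [trace_eq_sum_of_orthonormal hb, ← Finset.sum_neg_distrib]
      exact Finset.sum_congr rfl fun i _ => by rw [hρ, neg_neg]; rfl
    have h2 : 0 < ∑ i, B (ρ x (b i)) (ρ x (b i)) := by
      refine (Finset.sum_nonneg fun i _ => hnn _).lt_of_ne' fun h0 => hx (hinj ?_)
      rw [map_zero]
      refine b.ext fun i => ?_
      by_contra hi
      exact (hpos _ hi).ne'
        ((Finset.sum_eq_zero_iff_of_nonneg fun i _ => hnn _).1 h0 i (Finset.mem_univ i))
    simp only [LinearMap.neg_apply, LinearMap.compl₁₂_apply, LinearMap.compr₂_apply,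
      LinearMap.mul_apply', LieHom.coe_toLinearMap, h]
    linarith
  · have hbr : ∀ y, ρ ⁅x, y⁆ = ρ x * ρ y - ρ y * ρ x := fun y => by
      rw [LieHom.map_lie, LieRing.of_associative_ring_bracket]
    change -LinearMap.trace ℝ V (ρ ⁅x, y⁆ * ρ z) = - -LinearMap.trace ℝ V (ρ y * ρ ⁅x, z⁆)
    rw [hbr, hbr, sub_mul, mul_sub, map_sub, map_sub, ← mul_assoc (ρ y) (ρ z) (ρ x),
      LinearMap.trace_mul_comm ℝ (ρ y * ρ z) (ρ x), mul_assoc, mul_assoc]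
    ring

theorem mainTheorem6 {𝔤 𝔳 : Type*} [LieRing 𝔤] [LieAlgebra ℝ 𝔤] [FiniteDimensional ℝ 𝔤]
    [AddCommGroup 𝔳] [Module ℝ 𝔳] [FiniteDimensional ℝ 𝔳]
    (D : LieDataSet 𝔤 𝔳) (hD : D.IsLorentzian) :
    ¬ LieAlgebra.IsSemisimple ℝ 𝔤 ∧ LieAlgebra.center ℝ 𝔤 ≠ ⊥ := by
  suffices h : LieAlgebra.center ℝ 𝔤 ≠ ⊥ from ⟨fun _ => h (LieAlgebra.center_eq_bot ℝ 𝔤), h⟩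
  intro hcenter
  have hc : ∀ x : 𝔤, (∀ y : 𝔤, ⁅x, y⁆ = 0) → x = 0 := fun x hx => by
    rw [← LieSubmodule.mem_bot (R := ℝ) (L := 𝔤), ← hcenter, LieModule.mem_maxTrivSubmodule]
    exact fun y => by rw [← lie_skew, hx, neg_zero]
  have hGs : ∀ x y, D.formG x y = D.formG y x := fun x y => D.formG_symm.eq x y
  have hVs : ∀ x y, D.formV x y = D.formV y x := fun x y => D.formV_symm.eq x y
  have hGn : ∀ x, (∀ y, D.formG x y = 0) → x = 0 := D.formG_nondegenerate.1
  have hVn : ∀ x, (∀ y, D.formV x y = 0) → x = 0 := D.formV_nondegenerate.1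
  have had : ∀ x v w : 𝔤, D.formG ⁅x, v⁆ w = -D.formG v ⁅x, w⁆ := fun (x : 𝔤) v w => by
    have := LinearMap.mem_skewAdjointSubmodule _ |>.1 (D.ad_mem_so x) v w
    simpa [-lie_skew] using this
  have hπ : ∀ x v w, D.formV (D.π x v) w = -D.formV v (D.π x w) := fun (x : 𝔤) v w => by
    have := LinearMap.mem_skewAdjointSubmodule _ |>.1 (D.π_mem_so x) v w
    simpa using this
  have hB : LorentzForm D.metric := lorentzForm_of_sigNeg_eq_one
    (fun x y => by simp only [D.metric_apply, hGs x.1, hVs x.2])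
    (fun x h => Prod.ext (hGn _ fun y => by simpa [D.metric_apply] using h (y, 0))
      (hVn _ fun y => by simpa [D.metric_apply] using h (0, y))) hD
  by_cases hV : ∃ p, D.formV p p < 0
  · obtain ⟨p, hp⟩ := hV
    have hκ : InvariantInnerForm D.formG := ⟨hGs, fun x hx => by
      simpa [D.metric_apply] using hB.pos (0, p) (x, 0) (by simpa [D.metric_apply] using hp)
        (by simp [D.metric_apply]) (by simpa using hx), had⟩
    have hL : LorentzForm D.formV := ⟨hVs, fun p x hp hx h0 => by
      simpa [D.metric_apply] using hB.pos (0, p) (0, x) (by simpa [D.metric_apply] using hp)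
        (by simpa [D.metric_apply] using hx) (by simpa using h0)⟩
    obtain ⟨u, hu, h⟩ := exists_fixed_vector_of_lorentz hκ hc _ rfl hL hπ p hp
    refine hu ((Submodule.mem_bot ℝ).1 (D.iInf_ker_π ▸ ?_))
    simpa [Submodule.mem_iInf] using h
  · push Not at hV
    obtain ⟨q, hq⟩ := exists_neg_of_sigNeg_eq_one hD
    have hq1 : D.formG q.1 q.1 < 0 := by
      rw [D.metric_apply] at hq
      linarith [hV q.2]
    obtain ⟨κ, hκ⟩ := exists_invariantInnerForm_of_faithful D.π_faithful hVs
      (pos_of_forall_nonneg hVs hVn hV) hπ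
    have hL : LorentzForm D.formG := ⟨hGs, fun p x hp hx h0 => by
      simpa [D.metric_apply] using hB.pos (p, 0) (x, 0) (by simpa [D.metric_apply] using hp)
        (by simpa [D.metric_apply] using hx) (by simpa using h0)⟩
    obtain ⟨u, hu, h⟩ := exists_fixed_vector_of_lorentz (ρ := LieAlgebra.ad ℝ 𝔤) hκ hc _ rfl hL
      had q.1 hq1
    exact hu (hc u fun y => by
      rw [← lie_skew, ← LieAlgebra.ad_apply ℝ, h, neg_zero])
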